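/- Let $A$ be an associative ring with unit. A class $\mathcal C$ of left $A$-modules is called exact if, for every short exact sequence $0\to X\to Y\to Z\to 0$ of left $A$-modules two of whose terms belong to $\mathcal C$, the third term also belongs to $\mathcal C$; it is called cocomplete if every colimit of a (small) filtered system of modules in $\mathcal C$ belongs to $\mathcal C$. The ring $A$ is called regular on the left if the class of all left $A$-modules is the only cocomplete exact class of left $A$-modules containing every finitely generated projective left $A$-module. Theorem 7. Let $A$ be a ring that is regular on the left. Then every acyclic complex $$\cdots\to C_{n+1}\to C_n\to C_{n-1}\to\cdots\qquad(n\in\mathbb Z)$$ of projective right $A$-modules is contractible, i.e. its identity map is chain homotopic to zero. -/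

import Mathlib

open CategoryTheory

universe w v u

/-- A class `P` of objects of an abelian category is *exact* if, for every short exact sequence
`0 ⟶ X ⟶ Y ⟶ Z ⟶ 0` two of whose terms belong to `P`, the third one belongs to `P` too. -/
structure IsExactClass {M : Type u} [Category.{v} M] [Abelian M] (P : ObjectProperty M) :
    Prop where
  left : ∀ S : ShortComplex M, S.ShortExact → P S.X₂ → P S.X₃ → P S.X₁
  middle : ∀ S : ShortComplex M, S.ShortExact → P S.X₁ → P S.X₃ → P S.X₂
  right : ∀ S : ShortComplex M, S.ShortExact → P S.X₁ → P S.X₂ → P S.X₃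

/-- A class `P` of objects of a category is *cocomplete* if every colimit of a filtered system
(indexed by a `w`-small filtered category) of objects of `P` belongs to `P`. -/
def IsCocompleteClass {M : Type u} [Category.{v} M] (P : ObjectProperty M) : Prop :=
  ∀ (J : Type w) [SmallCategory J] [IsFiltered J], P.IsClosedUnderColimitsOfShape J

/-- The ring `A` is *regular on the left* if the class of all left `A`-modules is the only
cocomplete exact class of left `A`-modules which contains every finitely generated projective
left `A`-module. -/
def IsLeftRegularRing (A : Type u) [Ring A] : Prop :=
  ∀ P : ObjectProperty (ModuleCat.{u} A),
    IsExactClass P → IsCocompleteClass.{u} P →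
    (∀ X : ModuleCat.{u} A, Module.Finite A X → Module.Projective A X → P X) →
    ∀ X : ModuleCat.{u} A, P X

/-- A complex is *contractible* if its identity is chain homotopic to zero. -/
def IsContractibleComplex {M : Type u} [Category.{v} M] [Preadditive M] (C : ChainComplex M ℤ) :
    Prop :=
  Nonempty (Homotopy (𝟙 C) 0)

/-! Sum the complex into one projective right module with a square-zero endomorphism `f` satisfying
ker `f` = im `f`, and make the module free by adding a contractible piece. The left modules M for
which `f` ⊗ M is exact form a cocomplete exact class containing the finitely generated projectives,
hence are all left modules (`tensorExact_of_isLeftRegularRing`). So the cycles form a pure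
submodule, and since the ambient module is free, purity takes an elementwise form: finitely many
cycles are fixed by some endomorphism with values in the cycles
(`isLocallySplitExact_of_tensorExact`).

It remains to make the local splittings global (`IsLocallySplitExact.exists_retraction`). On
suitable countable sets of basis elements a telescoping argument makes the module of boundaries
projective, so every countable set lies in one spanning a split exact subobject. Dividing by a split
exact subobject spanned by basis elements preserves freeness and local splitness, so such subobjects
can be enlarged past any basis element, and Zorn's lemma reaches the whole module. Restricting the
resulting retraction onto cycles to each degree yields the contraction. -/

section Periodic

/-! ### Locally split exact differentials on a module -/

variable {B : Type*} [Ring B]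

/-- A module is projective as soon as its identity is the pointwise eventual limit of a coherent
sequence of endomorphisms factoring through a projective module. -/
theorem projective_of_eventually_factor {F L : Type*} [AddCommGroup F] [Module B F]
    [AddCommGroup L] [Module B L] [Module.Projective B L]
    (α : ℕ → F →ₗ[B] L) (φ : ℕ → L →ₗ[B] F)
    (hcoh : ∀ n v, φ (n + 1) (α (n + 1) (φ n (α n v))) = φ n (α n v))
    (hev : ∀ v, ∃ N, ∀ n, N ≤ n → φ n (α n v) = v) :
    Module.Projective B F := by
  classical
  -- The shift with `ψ 0 = 0` makes the increments `ψ (n + 1) - ψ n = φ n ∘ c n`, for `c` below,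
  -- telescope from zero. Each `c n v` vanishes for large `n`, so the `c n` assemble into a map to a
  -- direct sum of copies of `L`.
  let ψ : ℕ → F →ₗ[B] F := fun n => Nat.rec 0 (fun k _ => φ k ∘ₗ α k) n
  have hψ : ∀ n v, ψ (n + 1) v = φ n (α n v) := fun n v => rfl
  have hψ0 : ∀ v, ψ 0 v = 0 := fun v => rfl
  have hev' : ∀ v, ∃ N, ∀ n, N ≤ n → ψ n v = v := fun v => by
    obtain ⟨N, hN⟩ := hev v
    refine ⟨N + 1, fun n hn => ?_⟩
    obtain ⟨k, rfl⟩ : ∃ k, n = k + 1 := ⟨n - 1, by omega⟩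
    exact hN k (by omega)
  have hcoh' : ∀ n v, φ n (α n (ψ n v)) = ψ n v := fun n v => by
    cases n with
    | zero => simp [hψ0]
    | succ k => simp only [hψ, hcoh]
  let c : ℕ → F →ₗ[B] L := fun n => α n ∘ₗ (LinearMap.id - ψ n)
  have hc : ∀ n v, c n v = α n (v - ψ n v) := fun n v => rfl
  have hfin : ∀ v, (Function.support fun n => c n v).Finite := fun v => by
    obtain ⟨N, hN⟩ := hev' v
    refine (Set.finite_lt_nat N).subset fun n hn => ?_
    by_contra h
    exact hn (by simp [hc, hN n (not_lt.mp h)])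
  let i : F →ₗ[B] (ℕ →₀ L) :=
    { toFun := fun v => Finsupp.ofSupportFinite (fun n => c n v) (hfin v)
      map_add' := fun v w => Finsupp.ext fun n => map_add (c n) v w
      map_smul' := fun b v => Finsupp.ext fun n => map_smul (c n) b v }
  let s : (ℕ →₀ L) →ₗ[B] F := Finsupp.lsum ℕ φ
  have : Module.Projective B (ℕ →₀ L) :=
    Module.Projective.of_equiv (finsuppLequivDFinsupp (ι := ℕ) (M := L) B).symm
  refine Module.Projective.of_split i s (LinearMap.ext fun v => ?_)
  obtain ⟨N, hN⟩ := hev' v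
  have hsum : s (i v) = ∑ n ∈ Finset.range N, φ n (c n v) := by
    refine Finsupp.sum_of_support_subset (i v) (fun n hn => ?_) (fun n => φ n) (by simp)
    rw [Finset.mem_range]
    by_contra h
    refine (Finsupp.mem_support_iff.mp hn) ?_
    change c n v = 0
    simp [hc, hN n (not_lt.mp h)]
  have htel : ∀ m, ∑ n ∈ Finset.range m, φ n (c n v) = ψ m v := fun m => by
    induction m with
    | zero => simp [hψ0]
    | succ k ih => rw [Finset.sum_range_succ, ih, hc, map_sub, map_sub, hcoh', hψ]; abel
  rw [LinearMap.comp_apply, hsum, htel, hN N le_rfl, LinearMap.id_apply]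

/-- A differential `f` on a module, exact and such that every finite set of cycles is fixed by
an endomorphism with values in the cycles. -/
structure IsLocallySplitExact {P : Type*} [AddCommGroup P] [Module B P] (f : P →ₗ[B] P) :
    Prop where
  d_comp_d : ∀ p, f (f p) = 0
  exact : ∀ p, f p = 0 → ∃ q, f q = p
  locallySplit : ∀ S : Finset P, (∀ s ∈ S, f s = 0) →
    ∃ φ : P →ₗ[B] P, (∀ p, f (φ p) = 0) ∧ ∀ s ∈ S, φ s = s

/-- Let `σ` be a section of a surjection `π` onto a projective module, compatible with
differentials `f` and `g`, whose kernel is exact with a retraction `r` onto its cycles. Then `σ`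
can be modified to map cycles to cycles. -/
theorem exists_section_preserving_cycles {P Q : Type*} [AddCommGroup P] [Module B P]
    [AddCommGroup Q] [Module B Q] [Module.Projective B Q] {f : P →ₗ[B] P} {g : Q →ₗ[B] Q}
    (hff : ∀ p, f (f p) = 0)
    (π : P →ₗ[B] Q) (σ : Q →ₗ[B] P) (hσ : ∀ q, π (σ q) = q) (hπ : ∀ p, π (f p) = g (π p))
    (hker : ∀ p, π p = 0 → f p = 0 → ∃ q, π q = 0 ∧ f q = p)
    (r : P →ₗ[B] P) (hr : ∀ p, π (r p) = 0 ∧ f (r p) = 0)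
    (hr' : ∀ p, π p = 0 → f p = 0 → r p = p) :
    ∃ θ : Q →ₗ[B] P, (∀ q, π (θ q) = q) ∧ ∀ q, g q = 0 → f (θ q) = 0 := by
  let Z : Submodule B P := LinearMap.ker π ⊓ LinearMap.ker f
  have hmem : ∀ p, p ∈ Z ↔ π p = 0 ∧ f p = 0 := fun p => by simp [Z]
  let f' : LinearMap.ker π →ₗ[B] Z := LinearMap.codRestrict Z (f ∘ₗ (LinearMap.ker π).subtype)
    fun p => (hmem _).2 ⟨by
      have := p.2
      rw [LinearMap.mem_ker] at this
      simp [hπ, this], by simp [hff]⟩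
  have hf' : Function.Surjective f' := fun z => by
    obtain ⟨q, hq, hq'⟩ := hker z.1 ((hmem _).1 z.2).1 ((hmem _).1 z.2).2
    exact ⟨⟨q, hq⟩, Subtype.ext hq'⟩
  let r' : P →ₗ[B] Z := LinearMap.codRestrict Z r fun p => (hmem _).2 (hr p)
  -- For a cycle `q`, `f (σ q)` is a cycle in the kernel of `π`, so `r` fixes it and subtracting `h
  -- q` kills it. Inserting `r` makes the lifting problem meaningful on all of `Q`.
  obtain ⟨h, hh⟩ := Module.projective_lifting_property f' (r' ∘ₗ f ∘ₗ σ) hf'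
  have hh' : ∀ q, f (h q) = r (f (σ q)) := fun q => congrArg Subtype.val (LinearMap.congr_fun hh q)
  have hh0 : ∀ q, π (h q) = 0 := fun q => (h q).2
  refine ⟨σ - (LinearMap.ker π).subtype ∘ₗ h, fun q => ?_, fun q hq => ?_⟩
  · simp [hσ, hh0]
  · have : r (f (σ q)) = f (σ q) := hr' _ (by rw [hπ, hσ, hq]) (hff _)
    simp [hh', this]

/-- Local split exactness passes to quotients by split exact subobjects. -/
theorem IsLocallySplitExact.of_section {P Q : Type*} [AddCommGroup P] [Module B P]
    [AddCommGroup Q] [Module B Q] {f : P →ₗ[B] P} {g : Q →ₗ[B] Q}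
    (hf : IsLocallySplitExact f)
    (π : P →ₗ[B] Q) (hπ : ∀ p, π (f p) = g (π p))
    (θ : Q →ₗ[B] P) (hθ : ∀ q, π (θ q) = q) (hθ' : ∀ q, g q = 0 → f (θ q) = 0) :
    IsLocallySplitExact g where
  d_comp_d q := by rw [← hθ q, ← hπ, ← hπ, hf.d_comp_d, map_zero]
  exact q hq := by
    obtain ⟨p, hp⟩ := hf.exact _ (hθ' q hq)
    exact ⟨π p, by rw [← hπ, hp, hθ]⟩
  locallySplit S hS := by
    classical
    obtain ⟨φ, hφ, hφ'⟩ := hf.locallySplit (S.image θ) fun s hs => by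
      obtain ⟨q, hq, rfl⟩ := Finset.mem_image.mp hs
      exact hθ' q (hS q hq)
    refine ⟨π ∘ₗ φ ∘ₗ θ, fun p => ?_, fun s hs => ?_⟩
    · simp [← hπ, hφ]
    · simp [hφ' _ (Finset.mem_image_of_mem θ hs), hθ]

/-! ### Splitting on free modules: countable pieces and Zorn's lemma -/

section Free

variable {X : Type*} {f : (X →₀ B) →ₗ[B] (X →₀ B)}

theorem map_supported_le_iff {W W' : Set X} :
    (Finsupp.supported B B W).map f ≤ Finsupp.supported B B W' ↔
      ∀ x ∈ W, f (Finsupp.single x 1) ∈ Finsupp.supported B B W' := by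
  rw [Finsupp.supported_eq_span_single, Submodule.map_span, Submodule.span_le]
  simp [Set.subset_def]

/-- In a locally split exact differential on a free module, finitely many boundaries are fixed by
an endomorphism whose values are boundaries of a finite rank submodule. -/
theorem IsLocallySplitExact.exists_finset (hf : IsLocallySplitExact f) (T : Finset X) :
    ∃ (E : Finset X) (φ : (X →₀ B) →ₗ[B] (X →₀ B)),
      (∀ p, φ p ∈ (Finsupp.supported B B (E : Set X)).map f) ∧
      ∀ p ∈ (Finsupp.supported B B (T : Set X)).map f, φ p = p := by
  classical
  obtain ⟨φ, hφ, hφT⟩ := hf.locallySplit (T.image fun x => f (Finsupp.single x 1)) fun s hs => by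
    obtain ⟨x, -, rfl⟩ := Finset.mem_image.mp hs
    exact hf.d_comp_d _
  choose q hq using fun y => hf.exact _ (hφ (Finsupp.single y 1))
  -- Boundaries of `T` involve only the basis elements in `D`. Truncating `φ` to zero off `D` keeps
  -- it the identity on them and leaves finitely many preimages `q y` to accommodate.
  let D : Finset X := T.biUnion fun x => (f (Finsupp.single x 1)).support
  let ρ : X → X →₀ B := fun y => if y ∈ D then φ (Finsupp.single y 1) else 0
  refine ⟨D.biUnion fun y => (q y).support, Finsupp.linearCombination B ρ, fun p => ?_, ?_⟩
  · rw [Finsupp.linearCombination_apply]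
    refine AddSubmonoidClass.finsuppSum_mem _ _ _ fun y _ => Submodule.smul_mem _ _ ?_
    by_cases hy : y ∈ D
    · refine ⟨q y, ?_, by simp [ρ, hy, hq]⟩
      rw [SetLike.mem_coe, Finsupp.mem_supported]
      exact_mod_cast Finset.subset_biUnion_of_mem (fun y => (q y).support) hy
    · simp [ρ, hy]
  · intro p hp
    rw [Finsupp.supported_eq_span_single, Submodule.map_span] at hp
    refine LinearMap.eqOn_span (f := Finsupp.linearCombination B ρ) (g := LinearMap.id) ?_ hp
    rintro _ ⟨_, ⟨x, hx, rfl⟩, rfl⟩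
    have hx' := hφT _ (Finset.mem_image_of_mem _ hx)
    change Finsupp.linearCombination B ρ (f (Finsupp.single x 1)) = f (Finsupp.single x 1)
    refine Eq.trans ?_ hx'
    have : φ = Finsupp.linearCombination B fun y => φ (Finsupp.single y 1) := by ext; simp
    rw [this, Finsupp.linearCombination_apply, Finsupp.linearCombination_apply]
    refine Finsupp.sum_congr fun y hy => ?_
    have : y ∈ D := Finset.mem_biUnion.mpr ⟨x, hx, hy⟩
    simp [ρ, this]

theorem exists_monotone_seq_of_countable_step {R : Set X → Set X → Prop}
    (hR : ∀ W : Set X, W.Countable → ∃ W' : Set X, W'.Countable ∧ W ⊆ W' ∧ R W W')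
    {W₀ : Set X} (hW₀ : W₀.Countable) :
    ∃ W : ℕ → Set X, Monotone W ∧ W 0 = W₀ ∧ (∀ n, (W n).Countable) ∧
      ∀ n, R (W n) (W (n + 1)) := by
  choose N hN₁ hN₂ hN₃ using fun W : {W : Set X // W.Countable} => hR W.1 W.2
  let V : ℕ → {W : Set X // W.Countable} := fun n => Nat.rec ⟨W₀, hW₀⟩ (fun _ W => ⟨N W, hN₁ W⟩) n
  exact ⟨fun n => (V n).1, monotone_nat_of_le_succ fun n => hN₂ (V n), rfl, fun n => (V n).2,
    fun n => hN₃ (V n)⟩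

theorem exists_mem_supported_of_monotone {W : ℕ → Set X} (hW : Monotone W) {p : X →₀ B}
    (hp : p ∈ Finsupp.supported B B (⋃ n, W n)) : ∃ n, p ∈ Finsupp.supported B B (W n) :=
  hW.directed_le.exists_mem_subset_of_finset_subset_biUnion hp

/-- A countable set has only countably many finite subsets, so each closing-off step stays
countable; a finite subset of the union already lies in one stage. -/
theorem exists_countable_closed (E : Finset X → Finset X) {W₀ : Set X} (hW₀ : W₀.Countable) :
    ∃ W : Set X, W.Countable ∧ W₀ ⊆ W ∧ ∀ T : Finset X, (T : Set X) ⊆ W → (E T : Set X) ⊆ W := by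
  obtain ⟨W, hmono, h0, hc, hE⟩ := exists_monotone_seq_of_countable_step
    (R := fun W W' => ∀ T : Finset X, (T : Set X) ⊆ W → (E T : Set X) ⊆ W')
    (fun W hW => by
      refine ⟨W ∪ ⋃ T ∈ {T : Finset X | (T : Set X) ⊆ W}, (E T : Set X), hW.union ?_,
        Set.subset_union_left, fun T hT => ?_⟩
      · refine Set.Countable.biUnion ?_ fun T _ => (E T).countable_toSet
        refine Set.MapsTo.countable_of_injOn (f := fun T : Finset X => (T : Set X))
          (t := {t | t.Finite ∧ t ⊆ W}) (fun T hT => ⟨T.finite_toSet, hT⟩)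
          (fun a _ b _ h => Finset.coe_injective h) (Set.countable_ofPred_finite_subset hW)
      · exact (Set.subset_biUnion_of_mem (u := fun T : Finset X => (E T : Set X)) hT).trans
          Set.subset_union_right) hW₀
  refine ⟨⋃ n, W n, Set.countable_iUnion hc, h0 ▸ Set.subset_iUnion W 0, fun T hT => ?_⟩
  obtain ⟨n, hn⟩ := hmono.directed_le.exists_mem_subset_of_finset_subset_biUnion hT
  exact (hE n T hn).trans (Set.subset_iUnion W (n + 1))

/-- The boundaries of a countable set of basis elements form a projective module if its finite
subsets have their boundaries fixed by endomorphisms with values in boundaries of finite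
subsets. -/
theorem projective_map_supported {E : Finset X → Finset X}
    {φ : Finset X → (X →₀ B) →ₗ[B] (X →₀ B)}
    (hE : ∀ T p, φ T p ∈ (Finsupp.supported B B (E T : Set X)).map f)
    (hφ : ∀ (T : Finset X), ∀ p ∈ (Finsupp.supported B B (T : Set X)).map f, φ T p = p)
    {W : Set X} (hW : W.Countable)
    (hWE : ∀ T : Finset X, (T : Set X) ⊆ W → (E T : Set X) ⊆ W) :
    Module.Projective B ((Finsupp.supported B B W).map f) := by
  classical
  rcases W.eq_empty_or_nonempty with rfl | hne
  · have : Subsingleton ((Finsupp.supported B B (∅ : Set X)).map f) := by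
      rw [Finsupp.supported_empty, Submodule.map_bot]
      infer_instance
    infer_instance
  obtain ⟨e, rfl⟩ := hW.exists_eq_range hne
  -- Including `e n` exhausts the set; including `E (T n)` puts the values of `φ (T n)` among
  -- boundaries of `T (n + 1)`, which `φ (T (n + 1))` fixes. This is the coherence needed for
  -- telescoping.
  obtain ⟨T, hT0, hT⟩ : ∃ T : ℕ → Finset X, T 0 = ∅ ∧
      ∀ n, T (n + 1) = insert (e n) (T n ∪ E (T n)) :=
    ⟨fun n => Nat.rec ∅ (fun n T => insert (e n) (T ∪ E T)) n, rfl, fun n => rfl⟩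
  let U : ℕ → Set X := fun n => (T n : Set X)
  have hmono : Monotone U := by
    refine monotone_nat_of_le_succ fun n x hx => ?_
    simp only [U, hT, Finset.mem_coe] at hx ⊢
    simp [hx]
  have hsub : ∀ n, (T n : Set X) ⊆ Set.range e := fun n => by
    induction n with
    | zero => simp [hT0]
    | succ n ih =>
      rw [hT, Finset.coe_insert, Finset.coe_union, Set.insert_subset_iff]
      exact ⟨⟨n, rfl⟩, Set.union_subset ih (hWE _ ih)⟩
  have hmem : ∀ n p, φ (T n) p ∈ (Finsupp.supported B B (T (n + 1) : Set X)).map f := fun n p => by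
    refine Submodule.map_mono (Finsupp.supported_mono ?_) (hE (T n) p)
    intro x hx
    rw [hT]
    simp only [Finset.mem_coe] at hx ⊢
    simp [hx]
  refine projective_of_eventually_factor (B := B) (L := X →₀ B)
    (F := (Finsupp.supported B B (Set.range e)).map f)
    (fun _ => Submodule.subtype ((Finsupp.supported B B (Set.range e)).map f))
    (fun n => LinearMap.codRestrict _ (φ (T n)) fun p =>
      Submodule.map_mono (Finsupp.supported_mono (hsub (n + 1))) (hmem n p)) ?_ ?_
  · intro n v
    exact Subtype.ext (hφ _ _ (hmem n v))
  · rintro ⟨_, p, hp, rfl⟩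
    have hp' : p ∈ Finsupp.supported B B (⋃ n, U n) := by
      refine Finsupp.supported_mono ?_ hp
      rintro _ ⟨n, rfl⟩
      exact Set.mem_iUnion.mpr ⟨n + 1, by simp [U, hT]⟩
    obtain ⟨N, hN⟩ := exists_mem_supported_of_monotone hmono hp'
    exact ⟨N, fun n hn => Subtype.ext
      (hφ (T n) _ ⟨p, Finsupp.supported_mono (hmono hn) hN, rfl⟩)⟩

/-- If the boundaries of a free submodule form a projective module, then it has an endomorphism
retracting onto the cycles. -/
theorem exists_retraction_of_projective (W : Set X)
    [Module.Projective B ((Finsupp.supported B B W).map f)] :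
    ∃ r : (X →₀ B) →ₗ[B] (X →₀ B), (∀ p, r p ∈ Finsupp.supported B B W ∧ f (r p) = 0) ∧
      ∀ p ∈ Finsupp.supported B B W, f p = 0 → r p = p := by
  classical
  let g := f.submoduleMap (Finsupp.supported B B W)
  have hg : Function.Surjective g := f.submoduleMap_surjective _
  obtain ⟨s, hs⟩ := Module.projective_lifting_property g LinearMap.id hg
  have hs' : ∀ y : (Finsupp.supported B B W).map f, f (s y) = y := fun y =>
    congrArg Subtype.val (LinearMap.congr_fun hs y)
  let ρ := Finsupp.restrictDom B B W
  let r : (X →₀ B) →ₗ[B] (X →₀ B) :=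
    (Finsupp.supported B B W).subtype ∘ₗ ρ - (Finsupp.supported B B W).subtype ∘ₗ s ∘ₗ g ∘ₗ ρ
  have hr : ∀ p, r p = ρ p - s (g (ρ p)) := fun p => rfl
  have hg' : ∀ p, (g p : X →₀ B) = f p := fun p => rfl
  refine ⟨r, fun p => ⟨?_, ?_⟩, fun p hp hfp => ?_⟩
  · exact Submodule.sub_mem _ (SetLike.coe_mem _) (SetLike.coe_mem _)
  · rw [hr, map_sub, hs', hg', sub_self]
  · have h1 : ρ p = ⟨p, hp⟩ :=
      LinearMap.congr_fun (Finsupp.restrictDom_comp_subtype W) ⟨p, hp⟩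
    have h2 : g ⟨p, hp⟩ = 0 := Subtype.ext hfp
    simp [hr, h1, h2]

/-- A locally split exact differential on a free module has arbitrarily large countable
subsets of the basis spanning split exact subobjects. -/
theorem IsLocallySplitExact.exists_countable (hf : IsLocallySplitExact f) {W₀ : Set X}
    (hW₀ : W₀.Countable) :
    ∃ (W : Set X) (r : (X →₀ B) →ₗ[B] (X →₀ B)), W₀ ⊆ W ∧
      (∀ p ∈ Finsupp.supported B B W, f p ∈ Finsupp.supported B B W) ∧
      (∀ p ∈ Finsupp.supported B B W, f p = 0 → ∃ q ∈ Finsupp.supported B B W, f q = p) ∧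
      (∀ p, r p ∈ Finsupp.supported B B W ∧ f (r p) = 0) ∧
      ∀ p ∈ Finsupp.supported B B W, f p = 0 → r p = p := by
  classical
  choose E φ hE hφ using hf.exists_finset
  choose! q hq using hf.exact
  obtain ⟨W, hmono, rfl, hc, hW⟩ := exists_monotone_seq_of_countable_step
    (R := fun W W' => (∀ T : Finset X, (T : Set X) ⊆ W → (E T : Set X) ⊆ W') ∧
      (Finsupp.supported B B W).map f ≤ Finsupp.supported B B W' ∧
      ∀ p ∈ Finsupp.supported B B W, f p = 0 → ∃ q ∈ Finsupp.supported B B W', f q = p)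
    (fun W hW => by
      -- There may be uncountably many cycles over `V`, so preimages cannot be added one by one. The
      -- retraction `r` writes each of them as a combination of the countably many `r (single x 1)`,
      -- and preimages of these suffice.
      obtain ⟨V, hV, hWV, hVE⟩ := exists_countable_closed E hW
      have := projective_map_supported hE hφ hV hVE
      obtain ⟨r, hr, hr'⟩ := exists_retraction_of_projective (f := f) V
      let D : X → Finset X := fun x =>
        (f (Finsupp.single x 1)).support ∪ (q (r (Finsupp.single x 1))).support
      have hD : ∀ x ∈ V, (D x : Set X) ⊆ V ∪ ⋃ x ∈ V, (D x : Set X) := fun x hx =>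
        (Set.subset_biUnion_of_mem (u := fun x => (D x : Set X)) hx).trans Set.subset_union_right
      refine ⟨V ∪ ⋃ x ∈ V, (D x : Set X),
        hV.union (hV.biUnion fun x _ => (D x).countable_toSet),
        hWV.trans Set.subset_union_left,
        fun T hT => (hVE T (hT.trans hWV)).trans Set.subset_union_left, ?_, ?_⟩
      · refine map_supported_le_iff.2 fun x hx => ?_
        rw [Finsupp.mem_supported]
        refine Set.Subset.trans ?_ (hD x (hWV hx))
        simp [D]
      · intro p hp hfp
        refine ⟨Finsupp.linearCombination B (fun x => q (r (Finsupp.single x 1))) p, ?_, ?_⟩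
        · rw [Finsupp.linearCombination_apply]
          refine AddSubmonoidClass.finsuppSum_mem _ _ _ fun x hx => Submodule.smul_mem _ _ ?_
          rw [Finsupp.mem_supported]
          refine Set.Subset.trans ?_ (hD x (hWV (hp (Finsupp.mem_support_iff.mpr hx))))
          simp [D]
        · have : f ∘ₗ Finsupp.linearCombination B (fun x => q (r (Finsupp.single x 1))) = r := by
            ext x : 2
            simp [hq _ (hr _).2]
          rw [← LinearMap.comp_apply, this, hr' p (Finsupp.supported_mono hWV hp) hfp]) hW₀
  have : Module.Projective B ((Finsupp.supported B B (⋃ n, W n)).map f) := by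
    refine projective_map_supported hE hφ (Set.countable_iUnion hc) fun T hT => ?_
    obtain ⟨n, hn⟩ := hmono.directed_le.exists_mem_subset_of_finset_subset_biUnion hT
    exact ((hW n).1 T hn).trans (Set.subset_iUnion W (n + 1))
  obtain ⟨r, hr, hr'⟩ := exists_retraction_of_projective (f := f) (⋃ n, W n)
  refine ⟨⋃ n, W n, r, Set.subset_iUnion W 0, fun p hp => ?_, fun p hp hfp => ?_, hr, hr'⟩
  · obtain ⟨n, hn⟩ := exists_mem_supported_of_monotone hmono hp
    exact Finsupp.supported_mono (Set.subset_iUnion W (n + 1))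
      ((hW n).2.1 (Submodule.mem_map_of_mem hn))
  · obtain ⟨n, hn⟩ := exists_mem_supported_of_monotone hmono hp
    obtain ⟨q, hq, hq'⟩ := (hW n).2.2 p hn hfp
    exact ⟨q, Finsupp.supported_mono (Set.subset_iUnion W (n + 1)) hq, hq'⟩

/-- A set of basis elements spanning an exact subobject of a differential on a free module,
together with a retraction of that subobject onto its cycles. -/
structure SplitPart (f : (X →₀ B) →ₗ[B] (X →₀ B)) where
  carrier : Set X
  -- Only values on the carrier matter; recording them on basis elements lets retractions be glued
  -- along chains.
  retr : X → X →₀ B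
  closed : ∀ p ∈ Finsupp.supported B B carrier, f p ∈ Finsupp.supported B B carrier
  exact : ∀ p ∈ Finsupp.supported B B carrier, f p = 0 →
    ∃ q ∈ Finsupp.supported B B carrier, f q = p
  retr_mem : ∀ x ∈ carrier, retr x ∈ Finsupp.supported B B carrier ∧ f (retr x) = 0
  retr_eq : ∀ p ∈ Finsupp.supported B B carrier, f p = 0 → Finsupp.linearCombination B retr p = p

/-- One split part extends another one. -/
def SplitPart.Le (a b : SplitPart f) : Prop :=
  a.carrier ⊆ b.carrier ∧ ∀ x ∈ a.carrier, b.retr x = a.retr x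

theorem linearCombination_congr {Y : Set X} {M : Type*} [AddCommGroup M] [Module B M]
    {ρ ρ' : X → M} (h : ∀ x ∈ Y, ρ x = ρ' x) {p : X →₀ B} (hp : p ∈ Finsupp.supported B B Y) :
    Finsupp.linearCombination B ρ p = Finsupp.linearCombination B ρ' p := by
  rw [Finsupp.linearCombination_apply, Finsupp.linearCombination_apply]
  exact Finsupp.sum_congr fun x hx => by rw [h x (hp hx)]

theorem linearCombination_mem {M : Type*} [AddCommGroup M] [Module B M] (N : Submodule B M)
    {ρ : X → M} {p : X →₀ B} (h : ∀ x ∈ p.support, ρ x ∈ N) :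
    Finsupp.linearCombination B ρ p ∈ N := by
  rw [Finsupp.linearCombination_apply]
  exact AddSubmonoidClass.finsuppSum_mem _ _ _ fun x hx =>
    N.smul_mem _ (h x (Finsupp.mem_support_iff.mpr hx))

/-- The quotient by the span of the carrier is free on the complement, and the retraction supplies a
section preserving cycles, so the quotient is again locally split. A countable split piece of it
containing `x` is pulled back. The carrier itself may have any cardinality. -/
theorem SplitPart.exists_extension (hf : IsLocallySplitExact f) (a : SplitPart f) (x : X) :
    ∃ b : SplitPart f, a.Le b ∧ x ∈ b.carrier := by
  classical
  by_cases hx : x ∈ a.carrier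
  · exact ⟨a, ⟨subset_rfl, fun _ _ => rfl⟩, hx⟩
  let Y := a.carrier
  let PY := Finsupp.supported B B Y
  let π : (X →₀ B) →ₗ[B] ((Yᶜ : Set X) →₀ B) := Finsupp.lsubtypeDomain (Yᶜ : Set X)
  have hπ_apply : ∀ p i, π p i = p i := fun p i => rfl
  let σ : ((Yᶜ : Set X) →₀ B) →ₗ[B] (X →₀ B) := Finsupp.lmapDomain B B Subtype.val
  have hσ : ∀ q, π (σ q) = q := fun q => Finsupp.ext fun i => by
    rw [hπ_apply]
    exact Finsupp.mapDomain_apply Subtype.val_injective q i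
  have hπ0 : ∀ p, π p = 0 ↔ p ∈ PY := fun p => by
    rw [Finsupp.mem_supported']
    exact ⟨fun h i hi => DFunLike.congr_fun h ⟨i, hi⟩, fun h => Finsupp.ext fun i => h i i.2⟩
  let g : ((Yᶜ : Set X) →₀ B) →ₗ[B] ((Yᶜ : Set X) →₀ B) := π ∘ₗ f ∘ₗ σ
  have hπ : ∀ p, π (f p) = g (π p) := fun p => by
    have : p - σ (π p) ∈ PY := by rw [← hπ0, map_sub, hσ, sub_self]
    have := (hπ0 _).2 (a.closed _ this)
    rw [map_sub, map_sub, sub_eq_zero] at this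
    exact this
  have hker : ∀ p, π p = 0 → f p = 0 → ∃ q, π q = 0 ∧ f q = p := fun p hp hfp => by
    obtain ⟨q, hq, hq'⟩ := a.exact p ((hπ0 p).1 hp) hfp
    exact ⟨q, (hπ0 q).2 hq, hq'⟩
  let ρ : X → X →₀ B := fun y => if y ∈ Y then a.retr y else 0
  let r : (X →₀ B) →ₗ[B] (X →₀ B) := Finsupp.linearCombination B ρ
  have hrPY : ∀ p ∈ PY, r p = Finsupp.linearCombination B a.retr p := fun p hp =>
    linearCombination_congr (fun y hy => if_pos hy) hp
  have hr : ∀ p, π (r p) = 0 ∧ f (r p) = 0 := fun p => by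
    have : r p ∈ PY ⊓ LinearMap.ker f := linearCombination_mem _ fun y _ => by
      by_cases hy : y ∈ Y
      · simp only [ρ, hy, if_true]
        exact a.retr_mem y hy
      · simp [ρ, hy]
    exact ⟨(hπ0 _).2 this.1, this.2⟩
  have hr' : ∀ p, π p = 0 → f p = 0 → r p = p := fun p hp hfp => by
    rw [hrPY p ((hπ0 p).1 hp), a.retr_eq p ((hπ0 p).1 hp) hfp]
  obtain ⟨θ, hθ, hθ'⟩ := exists_section_preserving_cycles hf.d_comp_d π σ hσ hπ hker r hr hr'
  obtain ⟨W, s, hxW, hWc, hWe, hs, hs'⟩ := (hf.of_section π hπ θ hθ hθ').exists_countable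
    (Set.countable_singleton (⟨x, hx⟩ : (Yᶜ : Set X)))
  let Z : Set X := {z | ∀ h : z ∈ Yᶜ, (⟨z, h⟩ : (Yᶜ : Set X)) ∈ W}
  have hYZ : Y ⊆ Z := fun y hy h => (h hy).elim
  have hZ : ∀ p, p ∈ Finsupp.supported B B Z ↔ π p ∈ Finsupp.supported B B W := fun p => by
    rw [Finsupp.mem_supported', Finsupp.mem_supported']
    refine ⟨fun h i hi => h i fun hi' => hi (hi' i.2), fun h i hi => ?_⟩
    simp only [Z, Set.mem_ofPred_eq, not_forall] at hi
    obtain ⟨h1, h2⟩ := hi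
    exact h ⟨i, h1⟩ h2
  -- On a cycle `p` over `Z`, `p - θ (π p)` is a cycle over `Y`, fixed by `r`, while `s` fixes `π
  -- p`. On `Y` the map `π` vanishes and `r'` reduces to `r`.
  let r' : (X →₀ B) →ₗ[B] (X →₀ B) := r ∘ₗ (LinearMap.id - θ ∘ₗ π) + θ ∘ₗ s ∘ₗ π
  have hr'_apply : ∀ p, r' p = r (p - θ (π p)) + θ (s (π p)) := fun p => rfl
  have hlc : Finsupp.linearCombination B (fun y => r' (Finsupp.single y 1)) = r' := by ext; simp
  refine ⟨⟨Z, fun y => r' (Finsupp.single y 1), fun p hp => ?_, fun p hp hfp => ?_,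
    fun y hy => ⟨?_, ?_⟩, fun p hp hfp => ?_⟩, ⟨hYZ, fun y hy => ?_⟩, fun h => hxW rfl⟩
  · rw [hZ] at hp ⊢
    rw [hπ]
    exact hWc _ hp
  · rw [hZ] at hp
    obtain ⟨q, hq, hq'⟩ := hWe _ hp (by rw [← hπ, hfp, map_zero])
    -- The preimage of `π p` lifts only up to an error, which is a cycle over `Y` and hence a
    -- boundary there.
    obtain ⟨q₁, hq₁, hq₁'⟩ := hker (p - f (σ q)) (by rw [map_sub, hπ, hσ, hq', sub_self])
      (by rw [map_sub, hfp, hf.d_comp_d, sub_self])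
    refine ⟨σ q + q₁, ?_, by rw [map_add, hq₁', add_sub_cancel]⟩
    rw [hZ, map_add, hq₁, hσ, add_zero]
    exact hq
  · rw [hZ, hr'_apply, map_add, (hr _).1, zero_add, hθ]
    exact (hs _).1
  · rw [hr'_apply, map_add, (hr _).2, zero_add]
    exact hθ' _ (hs _).2
  · rw [hZ] at hp
    have h0 : g (π p) = 0 := by rw [← hπ, hfp, map_zero]
    rw [hlc, hr'_apply, hs' _ hp h0, hr', sub_add_cancel]
    · rw [map_sub, hθ, sub_self]
    · rw [map_sub, hfp, hθ' _ h0, sub_self]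
  · have : π (Finsupp.single y 1) = 0 := (hπ0 _).2 (Finsupp.single_mem_supported B 1 hy)
    change r' (Finsupp.single y 1) = _
    rw [hr'_apply, this]
    simp [r, ρ, show y ∈ Y from hy, Y]

/-- Each condition concerns one finitely supported element, which already lives over a single member
of a nonempty chain. -/
theorem SplitPart.exists_upperBound {c : Set (SplitPart f)} (hc : IsChain SplitPart.Le c) :
    ∃ b : SplitPart f, ∀ a ∈ c, a.Le b := by
  classical
  have htot : ∀ a ∈ c, ∀ b ∈ c, a.Le b ∨ b.Le a := fun a ha b hb => by
    by_cases h : a = b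
    · exact Or.inl ⟨h ▸ subset_rfl, fun x _ => by rw [h]⟩
    · exact hc ha hb h
  let Y : Set X := ⋃ a ∈ c, a.carrier
  have hle : ∀ a ∈ c, a.carrier ⊆ Y := fun a ha =>
    Set.subset_biUnion_of_mem (u := SplitPart.carrier) ha
  have hex : ∀ x, x ∈ Y → ∃ a ∈ c, x ∈ a.carrier := fun x hx => by simpa [Y] using hx
  let ρ : X → X →₀ B := fun x => if h : x ∈ Y then (hex x h).choose.retr x else 0
  have hρ : ∀ a ∈ c, ∀ x ∈ a.carrier, ρ x = a.retr x := fun a ha x hx => by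
    have h := hle a ha hx
    obtain ⟨h1, h2⟩ := (hex x h).choose_spec
    simp only [ρ, h, dif_pos]
    rcases htot _ h1 a ha with h' | h'
    · exact (h'.2 x h2).symm
    · exact h'.2 x hx
  rcases c.eq_empty_or_nonempty with rfl | hne
  · exact ⟨⟨∅, fun _ => 0, by simp, by simp, by simp, by simp⟩, by simp⟩
  have hmem : ∀ p ∈ Finsupp.supported B B Y, ∃ a ∈ c, p ∈ Finsupp.supported B B a.carrier :=
    fun p hp => DirectedOn.exists_mem_subset_of_finset_subset_biUnion hne
      (fun a ha b hb => (htot a ha b hb).elim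
        (fun h => ⟨b, hb, h.1, subset_rfl⟩) fun h => ⟨a, ha, subset_rfl, h.1⟩) hp
  refine ⟨⟨Y, ρ, fun p hp => ?_, fun p hp hfp => ?_, fun x hx => ?_, fun p hp hfp => ?_⟩,
    fun a ha => ⟨hle a ha, fun x hx => hρ a ha x hx⟩⟩
  · obtain ⟨a, ha, hpa⟩ := hmem p hp
    exact Finsupp.supported_mono (hle a ha) (a.closed p hpa)
  · obtain ⟨a, ha, hpa⟩ := hmem p hp
    obtain ⟨q, hq, hq'⟩ := a.exact p hpa hfp
    exact ⟨q, Finsupp.supported_mono (hle a ha) hq, hq'⟩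
  · obtain ⟨a, ha, hxa⟩ := hex x hx
    rw [hρ a ha x hxa]
    exact ⟨Finsupp.supported_mono (hle a ha) (a.retr_mem x hxa).1, (a.retr_mem x hxa).2⟩
  · obtain ⟨a, ha, hpa⟩ := hmem p hp
    rw [linearCombination_congr (hρ a ha) hpa, a.retr_eq p hpa hfp]

/-- A locally split exact differential on a free module is split. -/
theorem IsLocallySplitExact.exists_retraction (hf : IsLocallySplitExact f) :
    ∃ r : (X →₀ B) →ₗ[B] (X →₀ B), (∀ p, f (r p) = 0) ∧ ∀ p, f p = 0 → r p = p := by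
  obtain ⟨m, hm⟩ := exists_maximal_of_chains_bounded (r := SplitPart.Le (f := f))
    (fun c hc => SplitPart.exists_upperBound hc)
    (fun h₁ h₂ => ⟨h₁.1.trans h₂.1, fun x hx => (h₂.2 x (h₁.1 hx)).trans (h₁.2 x hx)⟩)
  have huniv : ∀ x, x ∈ m.carrier := fun x => by
    obtain ⟨b, hb, hx⟩ := m.exists_extension hf x
    exact (hm b hb).1 hx
  have hmem : ∀ p : X →₀ B, p ∈ Finsupp.supported B B m.carrier := fun p x _ => huniv x
  refine ⟨Finsupp.linearCombination B m.retr, fun p => ?_, fun p hp => m.retr_eq p (hmem p) hp⟩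
  exact linearCombination_mem (LinearMap.ker f) fun x _ => (m.retr_mem x (huniv x)).2

end Free

end Periodic

/-! ### Tensoring a differential on a free right module with left modules -/

section Tensor

variable {A : Type*} [Ring A] {X : Type*}

/-- The canonical map `(p, m) ↦ p ⊗ m` from the free right module on `X` and a left module `M` to
their tensor product, realized as `X →₀ M`. -/
noncomputable def tmul (M : Type*) [AddCommGroup M] [Module A M] :
    (X →₀ Aᵐᵒᵖ) →+ M →+ (X →₀ M) where
  toFun p :=
    { toFun := fun m => p.mapRange (fun b => b.unop • m) (by simp)
      map_zero' := by ext; simp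
      map_add' := fun m n => by ext; simp }
  map_zero' := by ext; simp
  map_add' p q := by ext; simp [add_smul]

section

variable {M N : Type*} [AddCommGroup M] [Module A M] [AddCommGroup N] [Module A N]

theorem tmul_apply (p : X →₀ Aᵐᵒᵖ) (m : M) (x : X) : tmul M p m x = (p x).unop • m := rfl

theorem tmul_single (x : X) (b : Aᵐᵒᵖ) (m : M) :
    tmul M (Finsupp.single x b) m = Finsupp.single x (b.unop • m) :=
  Finsupp.mapRange_single (hf := by simp)

theorem tmul_smul (b : Aᵐᵒᵖ) (p : X →₀ Aᵐᵒᵖ) (m : M) :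
    tmul M (b • p) m = tmul M p (b.unop • m) := by
  ext x
  simp [tmul_apply, mul_smul]

/-- The map `f ⊗ M`, for an endomorphism `f` of a free right module. -/
noncomputable def tensorMap (f : (X →₀ Aᵐᵒᵖ) →ₗ[Aᵐᵒᵖ] (X →₀ Aᵐᵒᵖ)) (M : Type*) [AddCommGroup M]
    [Module A M] : (X →₀ M) →+ (X →₀ M) :=
  Finsupp.liftAddHom fun x => tmul M (f (Finsupp.single x 1))

variable (f : (X →₀ Aᵐᵒᵖ) →ₗ[Aᵐᵒᵖ] (X →₀ Aᵐᵒᵖ))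

theorem tensorMap_single (x : X) (m : M) :
    tensorMap f M (Finsupp.single x m) = tmul M (f (Finsupp.single x 1)) m :=
  Finsupp.liftAddHom_apply_single _ _ _

theorem tensorMap_tmul (p : X →₀ Aᵐᵒᵖ) (m : M) :
    tensorMap f M (tmul M p m) = tmul M (f p) m := by
  induction p using Finsupp.induction_linear with
  | zero => simp
  | add p q hp hq => simp [hp, hq]
  | single x b =>
    rw [tmul_single, tensorMap_single, ← tmul_smul, ← map_smul]
    simp

theorem tensorMap_mapRange (φ : M →ₗ[A] N) (u : X →₀ M) :
    tensorMap f N (Finsupp.mapRange.linearMap φ u) =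
      Finsupp.mapRange.linearMap φ (tensorMap f M u) := by
  induction u using Finsupp.induction_linear with
  | zero => simp
  | add u v hu hv => simp only [map_add, hu, hv]
  | single x m =>
    rw [Finsupp.mapRange.linearMap_apply, Finsupp.mapRange_single, tensorMap_single,
      tensorMap_single]
    ext y
    simp [tmul_apply]

theorem tensorMap_tensorMap (hf : ∀ p, f (f p) = 0) (u : X →₀ M) :
    tensorMap f M (tensorMap f M u) = 0 := by
  induction u using Finsupp.induction_linear with
  | zero => simp
  | add u v hu hv => simp only [map_add, hu, hv, add_zero]
  | single x m => rw [tensorMap_single, tensorMap_tmul, hf, map_zero, AddMonoidHom.zero_apply]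

end

/-- Exactness of `f ⊗ M`. -/
def TensorExact (f : (X →₀ Aᵐᵒᵖ) →ₗ[Aᵐᵒᵖ] (X →₀ Aᵐᵒᵖ)) (M : Type*) [AddCommGroup M]
    [Module A M] : Prop :=
  ∀ u, tensorMap f M u = 0 → ∃ v, tensorMap f M v = u

variable {f : (X →₀ Aᵐᵒᵖ) →ₗ[Aᵐᵒᵖ] (X →₀ Aᵐᵒᵖ)}

section

variable {M₁ M₂ M₃ : Type*} [AddCommGroup M₁] [Module A M₁] [AddCommGroup M₂] [Module A M₂]
  [AddCommGroup M₃] [Module A M₃] {i : M₁ →ₗ[A] M₂} {q : M₂ →ₗ[A] M₃}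

theorem mapRange_linearMap_exact (hi : Function.Injective i) (h : Function.Exact i q)
    {u : X →₀ M₂} (hu : Finsupp.mapRange.linearMap q u = 0) :
    ∃ v : X →₀ M₁, Finsupp.mapRange.linearMap i v = u := by
  have h0 : Function.invFun i 0 = 0 := by
    simpa using Function.leftInverse_invFun hi 0
  refine ⟨u.mapRange (Function.invFun i) h0, Finsupp.ext fun x => ?_⟩
  exact Function.invFun_eq ((h (u x)).1 (DFunLike.congr_fun hu x))

theorem mapRange_linearMap_comp_eq_zero (h : Function.Exact i q) (u : X →₀ M₁) :
    Finsupp.mapRange.linearMap q (Finsupp.mapRange.linearMap i u) = 0 := by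
  ext x
  simp [h.apply_apply_eq_zero]

/-- Since M ↦ `X →₀ M` is exact, a short exact sequence of modules gives one of differential
modules, whose homologies form an exact triangle: if two vanish, so does the third. This and the
next two lemmas are the corresponding chases. -/
theorem TensorExact.left (hf : ∀ p, f (f p) = 0) (hi : Function.Injective i)
    (hq : Function.Surjective q) (h : Function.Exact i q)
    (h₂ : TensorExact f M₂) (h₃ : TensorExact f M₃) : TensorExact f M₁ := fun u hu => by
  have hi' : Function.Injective (Finsupp.mapRange.linearMap (α := X) i) :=
    Finsupp.mapRange_injective i (map_zero i) hi
  obtain ⟨v₂, hv₂⟩ := h₂ (Finsupp.mapRange.linearMap i u) (by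
    rw [tensorMap_mapRange, hu, map_zero])
  obtain ⟨w₃, hw₃⟩ := h₃ (Finsupp.mapRange.linearMap q v₂) (by
    rw [tensorMap_mapRange, hv₂, mapRange_linearMap_comp_eq_zero h])
  obtain ⟨w₂, rfl⟩ := Finsupp.mapRange_surjective q (map_zero q) hq w₃
  obtain ⟨v₁, hv₁⟩ := mapRange_linearMap_exact hi h (u := v₂ - tensorMap f M₂ w₂) (by
    rw [map_sub, ← hw₃, ← tensorMap_mapRange, sub_eq_zero]
    rfl)
  refine ⟨v₁, hi' ?_⟩
  rw [← tensorMap_mapRange, hv₁, map_sub, hv₂, tensorMap_tensorMap f hf, sub_zero]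

theorem TensorExact.middle (hf : ∀ p, f (f p) = 0) (hi : Function.Injective i)
    (hq : Function.Surjective q) (h : Function.Exact i q)
    (h₁ : TensorExact f M₁) (h₃ : TensorExact f M₃) : TensorExact f M₂ := fun u hu => by
  have hi' : Function.Injective (Finsupp.mapRange.linearMap (α := X) i) :=
    Finsupp.mapRange_injective i (map_zero i) hi
  obtain ⟨w₃, hw₃⟩ := h₃ (Finsupp.mapRange.linearMap q u) (by
    rw [tensorMap_mapRange, hu, map_zero])
  obtain ⟨w₂, rfl⟩ := Finsupp.mapRange_surjective q (map_zero q) hq w₃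
  obtain ⟨u₁, hu₁⟩ := mapRange_linearMap_exact hi h (u := u - tensorMap f M₂ w₂) (by
    rw [map_sub, ← hw₃, ← tensorMap_mapRange, sub_eq_zero]
    rfl)
  obtain ⟨v₁, hv₁⟩ := h₁ u₁ (hi' (by
    rw [← tensorMap_mapRange, hu₁, map_sub, hu, tensorMap_tensorMap f hf, sub_zero, map_zero]))
  refine ⟨w₂ + Finsupp.mapRange.linearMap i v₁, ?_⟩
  rw [map_add, tensorMap_mapRange, hv₁, hu₁, add_sub_cancel]

theorem TensorExact.right (hf : ∀ p, f (f p) = 0) (hi : Function.Injective i)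
    (hq : Function.Surjective q) (h : Function.Exact i q)
    (h₁ : TensorExact f M₁) (h₂ : TensorExact f M₂) : TensorExact f M₃ := fun u hu => by
  have hi' : Function.Injective (Finsupp.mapRange.linearMap (α := X) i) :=
    Finsupp.mapRange_injective i (map_zero i) hi
  obtain ⟨u₂, rfl⟩ := Finsupp.mapRange_surjective q (map_zero q) hq u
  change tensorMap f M₃ (Finsupp.mapRange.linearMap q u₂) = 0 at hu
  obtain ⟨u₁, hu₁⟩ := mapRange_linearMap_exact hi h (u := tensorMap f M₂ u₂) (by
    rw [← tensorMap_mapRange, hu])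
  obtain ⟨v₁, hv₁⟩ := h₁ u₁ (hi' (by
    rw [← tensorMap_mapRange, hu₁, tensorMap_tensorMap f hf, map_zero]))
  obtain ⟨w₂, hw₂⟩ := h₂ (u₂ - Finsupp.mapRange.linearMap i v₁) (by
    rw [map_sub, tensorMap_mapRange, hv₁, hu₁, sub_self])
  refine ⟨Finsupp.mapRange.linearMap q w₂, ?_⟩
  rw [tensorMap_mapRange, hw₂, map_sub, mapRange_linearMap_comp_eq_zero h, sub_zero]
  rfl

end

theorem tensorExact_self (hf : ∀ p, f p = 0 → ∃ q, f q = p) : TensorExact f A := fun u hu => by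
  have key : ∀ w : X →₀ A, ∃ p : X →₀ Aᵐᵒᵖ, tmul A p 1 = w := fun w =>
    ⟨w.mapRange MulOpposite.op rfl, by ext x; simp [tmul_apply]⟩
  obtain ⟨p, rfl⟩ := key u
  rw [tensorMap_tmul] at hu
  obtain ⟨q, rfl⟩ := hf p (Finsupp.ext fun x => by
    simpa [tmul_apply] using DFunLike.congr_fun hu x)
  exact ⟨tmul A q 1, tensorMap_tmul f q 1⟩

theorem tensorExact_of_finite_projective (hf : ∀ p, f p = 0 → ∃ q, f q = p) (M : Type*)
    [AddCommGroup M] [Module A M] [Module.Finite A M] [Module.Projective A M] :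
    TensorExact f M := fun u hu => by
  obtain ⟨n, g, s, -, -, hgs⟩ := Module.Finite.exists_comp_eq_id_of_projective A M
  choose v hv using fun j : Fin n => tensorExact_self hf
    (Finsupp.mapRange.linearMap (LinearMap.proj j ∘ₗ s) u) (by
      rw [tensorMap_mapRange, hu, map_zero])
  -- `M` is a retract of `A ^ n` through `s` and `g`: solve in each coordinate of `s`, then
  -- reassemble with the images under `g` of the standard basis.
  refine ⟨∑ j, Finsupp.mapRange.linearMap
    (LinearMap.toSpanSingleton A M (g (Pi.single j 1))) (v j), ?_⟩
  simp only [map_sum, tensorMap_mapRange, hv]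
  ext x
  have h1 : g (s (u x)) = u x := LinearMap.congr_fun hgs (u x)
  have h2 : s (u x) = ∑ j, s (u x) j • (Pi.single j 1 : Fin n → A) := by
    ext k
    simp [Finset.sum_apply, Pi.single_apply]
  rw [h2, map_sum] at h1
  simp only [map_smul] at h1
  simpa [Finsupp.finsetSum_apply] using h1

end Tensor

/-! ### Filtered colimits and the use of regularity -/

section Colimit

open Limits

variable {A : Type u} [Ring A] {X : Type u} {f : (X →₀ Aᵐᵒᵖ) →ₗ[Aᵐᵒᵖ] (X →₀ Aᵐᵒᵖ)}
  {J : Type u} [SmallCategory J] [IsFiltered J] {F : J ⥤ ModuleCat.{u} A} {c : Cocone F}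

theorem exists_finsupp_lift_of_isColimit (hc : IsColimit c) (u : X →₀ c.pt) :
    ∃ (j : J) (v : X →₀ F.obj j), Finsupp.mapRange.linearMap (c.ι.app j).hom v = u := by
  induction u using Finsupp.induction_linear with
  | zero => exact ⟨IsFiltered.nonempty.some, 0, map_zero _⟩
  | add u v hu hv =>
    obtain ⟨j, u, rfl⟩ := hu
    obtain ⟨k, v, rfl⟩ := hv
    refine ⟨IsFiltered.max j k,
      Finsupp.mapRange.linearMap (F.map (IsFiltered.leftToMax j k)).hom u +
      Finsupp.mapRange.linearMap (F.map (IsFiltered.rightToMax j k)).hom v, ?_⟩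
    rw [map_add]
    congr 1
    · rw [← LinearMap.comp_apply, ← Finsupp.mapRange.linearMap_comp, ← ModuleCat.hom_comp, c.w]
    · rw [← LinearMap.comp_apply, ← Finsupp.mapRange.linearMap_comp, ← ModuleCat.hom_comp, c.w]
  | single x m =>
    obtain ⟨j, y, rfl⟩ := Concrete.isColimit_exists_rep F hc m
    exact ⟨j, Finsupp.single x y, by simp⟩

theorem exists_finsupp_map_eq_zero_of_isColimit (hc : IsColimit c) {j : J} (v : X →₀ F.obj j)
    (hv : Finsupp.mapRange.linearMap (c.ι.app j).hom v = 0) :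
    ∃ (k : J) (g : j ⟶ k), Finsupp.mapRange.linearMap (F.map g).hom v = 0 := by
  classical
  have key : ∀ s : Finset X, ∃ (k : J) (g : j ⟶ k), ∀ x ∈ s, F.map g (v x) = 0 := fun s => by
    induction s using Finset.induction_on with
    | empty => exact ⟨j, 𝟙 j, by simp⟩
    | insert a s _ ih =>
      obtain ⟨k, g, hg⟩ := ih
      obtain ⟨l, h₁, h₂, h⟩ := Concrete.isColimit_exists_of_rep_eq.{u} F hc (v a) (0 : F.obj j) (by
        rw [map_zero]
        exact DFunLike.congr_fun hv a)
      rw [map_zero] at h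
      obtain ⟨n, p, q, hpq⟩ := IsFiltered.span g h₁
      refine ⟨n, g ≫ p, fun x hx => ?_⟩
      rcases Finset.mem_insert.mp hx with rfl | hx
      · rw [hpq, F.map_comp, ConcreteCategory.comp_apply, h, map_zero]
      · rw [F.map_comp, ConcreteCategory.comp_apply, hg x hx, map_zero]
  obtain ⟨k, g, hg⟩ := key v.support
  refine ⟨k, g, Finsupp.ext fun x => ?_⟩
  by_cases hx : x ∈ v.support
  · exact hg x hx
  · simp [Finsupp.notMem_support_iff.mp hx]

/-- By finite support, a cycle over the colimit comes from one stage and becomes a cycle at a later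
stage, where it bounds. -/
theorem tensorExact_of_isColimit (hc : IsColimit c) (h : ∀ j, TensorExact f (F.obj j)) :
    TensorExact f c.pt := fun u hu => by
  obtain ⟨j, u, rfl⟩ := exists_finsupp_lift_of_isColimit hc u
  rw [tensorMap_mapRange] at hu
  obtain ⟨k, g, hg⟩ := exists_finsupp_map_eq_zero_of_isColimit hc _ hu
  rw [← tensorMap_mapRange] at hg
  obtain ⟨v, hv⟩ := h k _ hg
  refine ⟨Finsupp.mapRange.linearMap (c.ι.app k).hom v, ?_⟩
  rw [tensorMap_mapRange, hv, ← LinearMap.comp_apply, ← Finsupp.mapRange.linearMap_comp,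
    ← ModuleCat.hom_comp, c.w]

theorem tensorExact_of_isLeftRegularRing (hA : IsLeftRegularRing A)
    (hf : ∀ p, f (f p) = 0) (hf' : ∀ p, f p = 0 → ∃ q, f q = p) (M : Type u) [AddCommGroup M]
    [Module A M] : TensorExact f M := by
  refine hA (fun N => TensorExact f N) ⟨fun S hS h₂ h₃ => ?_, fun S hS h₁ h₃ => ?_,
    fun S hS h₁ h₂ => ?_⟩ (fun J _ _ => ⟨fun N ⟨hN⟩ => ?_⟩) (fun N _ _ => ?_) (ModuleCat.of A M)
  · exact TensorExact.left hf hS.moduleCat_injective_f hS.moduleCat_surjective_g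
      ((ShortComplex.ShortExact.moduleCat_exact_iff_function_exact S).1 hS.exact) h₂ h₃
  · exact TensorExact.middle hf hS.moduleCat_injective_f hS.moduleCat_surjective_g
      ((ShortComplex.ShortExact.moduleCat_exact_iff_function_exact S).1 hS.exact) h₁ h₃
  · exact TensorExact.right hf hS.moduleCat_injective_f hS.moduleCat_surjective_g
      ((ShortComplex.ShortExact.moduleCat_exact_iff_function_exact S).1 hS.exact) h₁ h₂
  · exact tensorExact_of_isColimit hN.isColimit hN.prop_diag_obj
  · exact tensorExact_of_finite_projective hf' N

end Colimit

/-! ### From exactness of all tensor products to local splitness -/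

section LocallySplit

variable {A : Type u} [Ring A] {X : Type u} {f : (X →₀ Aᵐᵒᵖ) →ₗ[Aᵐᵒᵖ] (X →₀ Aᵐᵒᵖ)}

/-- If `f ⊗ M` is exact for all `M`, then `f` is locally split. -/
theorem isLocallySplitExact_of_tensorExact
    (hf : ∀ p, f (f p) = 0) (hf' : ∀ p, f p = 0 → ∃ q, f q = p)
    (h : ∀ (M : Type u) [AddCommGroup M] [Module A M], TensorExact f M) :
    IsLocallySplitExact f where
  d_comp_d := hf
  exact := hf'
  locallySplit S hS := by
    classical
    choose q hq using fun s : S => hf' s.1 (hS s.1 s.2)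
    -- `t` = ∑ s ⊗ e_s has coordinates `b x`, so it dies modulo `N`, and the chain `w` bounding it
    -- becomes a cycle there. Exactness over the quotient corrects `w` to a chain with coefficients
    -- in `N` that still bounds `t`.
    let b : X → (S → A) := fun x s => (s.1 x).unop
    let N : Submodule A (S → A) := Submodule.span A (Set.range b)
    let t : X →₀ (S → A) := ∑ s : S, tmul (S → A) s.1 (Pi.single s 1)
    have ht : ∀ x, t x = b x := fun x => by
      ext s
      simp [t, b, Finsupp.finsetSum_apply, tmul_apply, Finset.sum_apply, Pi.single_apply]
    let w : X →₀ (S → A) := ∑ s : S, tmul (S → A) (q s) (Pi.single s 1)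
    have hw : tensorMap f (S → A) w = t := by simp [w, t, tensorMap_tmul, hq]
    obtain ⟨v, hv⟩ := h ((S → A) ⧸ N) (Finsupp.mapRange.linearMap N.mkQ w) (by
      rw [tensorMap_mapRange, hw]
      ext x
      simp only [Finsupp.mapRange.linearMap_apply, Finsupp.mapRange_apply, ht]
      exact (Submodule.Quotient.mk_eq_zero N).2 (Submodule.subset_span ⟨x, rfl⟩))
    obtain ⟨v, rfl⟩ := Finsupp.mapRange_surjective N.mkQ (map_zero _) N.mkQ_surjective v
    have hN : ∀ y, (w - tensorMap f (S → A) v) y ∈ N := fun y => by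
      rw [← Submodule.Quotient.mk_eq_zero, ← Submodule.mkQ_apply, Finsupp.sub_apply, map_sub,
        sub_eq_zero]
      exact DFunLike.congr_fun (hv.symm.trans (tensorMap_mapRange f N.mkQ v)) y
    -- Tensors of the form ∑ φ(s) ⊗ e_s for one `φ` with values in the cycles; `t ∈ Φ` says that
    -- this `φ` fixes every `s`.
    let Φ : AddSubgroup (X →₀ (S → A)) :=
      { carrier := {t | ∃ φ : (X →₀ Aᵐᵒᵖ) →ₗ[Aᵐᵒᵖ] (X →₀ Aᵐᵒᵖ), (∀ p, f (φ p) = 0) ∧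
          ∀ (s : S) (y : X), t y s = (φ s.1 y).unop}
        zero_mem' := ⟨0, by simp, by simp⟩
        add_mem' := by
          rintro t t' ⟨φ, hφ, hφ'⟩ ⟨ψ, hψ, hψ'⟩
          exact ⟨φ + ψ, fun p => by simp [hφ, hψ], fun s y => by simp [hφ', hψ']⟩
        neg_mem' := by
          rintro t ⟨φ, hφ, hφ'⟩
          exact ⟨-φ, fun p => by simp [hφ], fun s y => by simp [hφ']⟩ }
    have hΦ : ∀ n ∈ N, ∀ (y : X) (a : A),
        tensorMap f (S → A) (Finsupp.single y (a • n)) ∈ Φ := fun n hn => by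
      induction hn using Submodule.span_induction with
      | mem n hn =>
        obtain ⟨x, rfl⟩ := hn
        intro y a
        -- The generator `b x` reads off the `x`-th coordinate, so the tensor comes from the
        -- rank-one map sending `p` to a multiple of the boundary `f (single y 1)`. Keeping `a`
        -- arbitrary absorbs scalars in the span induction.
        refine ⟨(Finsupp.lapply x).smulRight (MulOpposite.op a • f (Finsupp.single y 1)),
          fun p => by simp [hf], fun s z => ?_⟩
        rw [tensorMap_single]
        simp [tmul_apply, b, mul_assoc]
      | zero => simp
      | add n n' _ _ hn hn' =>
        intro y a
        rw [smul_add, Finsupp.single_add, map_add]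
        exact Φ.add_mem (hn y a) (hn' y a)
      | smul a n _ hn =>
        intro y a'
        rw [smul_smul]
        exact hn y _
    obtain ⟨φ, hφ, hφ'⟩ : t ∈ Φ := by
      have h1 : tensorMap f (S → A) (w - tensorMap f (S → A) v) = t := by
        rw [map_sub, hw, tensorMap_tensorMap f hf, sub_zero]
      rw [← h1, ← Finsupp.sum_single (w - tensorMap f (S → A) v), Finsupp.sum, map_sum]
      refine Φ.sum_mem fun y _ => ?_
      simpa using hΦ _ (hN y) y 1
    refine ⟨φ, hφ, fun s hs => Finsupp.ext fun y => MulOpposite.unop_injective ?_⟩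
    rw [← hφ' ⟨s, hs⟩ y, ht]

end LocallySplit

/-! ### Eilenberg swindle -/

section Swindle

variable {R : Type u} [Ring R]

/-- Finitely supported functions with values in a product. -/
noncomputable def finsuppProdValuesLEquiv (ι M N : Type*) [AddCommGroup M] [Module R M]
    [AddCommGroup N] [Module R N] : (ι →₀ M × N) ≃ₗ[R] (ι →₀ M) × (ι →₀ N) :=
  LinearEquiv.ofLinearMap
    ((Finsupp.mapRange.linearMap (LinearMap.fst R M N)).prod
      (Finsupp.mapRange.linearMap (LinearMap.snd R M N)))
    ((Finsupp.mapRange.linearMap (LinearMap.inl R M N)).coprod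
      (Finsupp.mapRange.linearMap (LinearMap.inr R M N)))
    (by ext <;> simp) (by ext <;> simp)

/-- Eilenberg swindle: a projective module becomes free after adding a suitable free module. -/
theorem exists_free_prod_free (P : Type u) [AddCommGroup P] [Module R P] [Module.Projective R P] :
    ∃ (Q : Type u) (_ : AddCommGroup Q) (_ : Module R Q),
      Module.Free R Q ∧ Module.Free R (P × Q) := by
  obtain ⟨K, _, _, ⟨e₁⟩⟩ : ∃ (K : Type u) (_ : AddCommGroup K) (_ : Module R K),
      Nonempty ((P →₀ R) ≃ₗ[R] K × P) := by
    let g : (P →₀ R) →ₗ[R] P := Finsupp.linearCombination R id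
    have hg : Function.Surjective g := Finsupp.linearCombination_id_surjective R P
    obtain ⟨s, hs⟩ := Module.projective_lifting_property g LinearMap.id hg
    exact ⟨LinearMap.ker g, inferInstance, inferInstance,
      ⟨(Function.Exact.splitSurjectiveEquiv (M := LinearMap.ker g) (N := P →₀ R) (P := P)
        (f := (LinearMap.ker g).subtype) (g := g) (LinearMap.exact_subtype_ker_map g)
        (LinearMap.ker g).injective_subtype ⟨s, hs⟩).1⟩⟩
  -- With K ⊕ P free, countably many copies of it form a free module, and `e₃` lets the copies of
  -- `P` in it absorb one more.
  let e₂ : (ℕ →₀ P →₀ R) ≃ₗ[R] (ℕ →₀ K) × (ℕ →₀ P) :=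
    (Finsupp.mapRange.linearEquiv e₁).trans (finsuppProdValuesLEquiv ℕ K P)
  let e₃ : (ℕ →₀ P) ≃ₗ[R] (ℕ →₀ P) × P :=
    (Finsupp.domLCongr (Equiv.natSumPUnitEquivNat.{0}).symm).trans
      ((Finsupp.sumFinsuppLEquivProdFinsupp R).trans
        ((LinearEquiv.refl R _).prodCongr (Finsupp.uniqueLinearEquiv R P PUnit.unit)))
  have hQ : Module.Free R ((ℕ →₀ K) × (ℕ →₀ P)) := Module.Free.of_equiv e₂
  refine ⟨(ℕ →₀ K) × (ℕ →₀ P), inferInstance, inferInstance, hQ, ?_⟩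
  exact Module.Free.of_equiv ((((LinearEquiv.refl R (ℕ →₀ K)).prodCongr e₃).trans
    (LinearEquiv.prodAssoc R _ _ _).symm).trans (LinearEquiv.prodComm R _ _))

end Swindle

/-! ### Retraction onto cycles for projective modules -/

section Contraction

variable {A : Type u} [Ring A]

theorem exists_retraction_onto_cycles (hA : IsLeftRegularRing A) {P : Type u} [AddCommGroup P]
    [Module Aᵐᵒᵖ P] [Module.Projective Aᵐᵒᵖ P] (d : P →ₗ[Aᵐᵒᵖ] P) (hd : ∀ p, d (d p) = 0)
    (hd' : ∀ p, d p = 0 → ∃ q, d q = p) :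
    ∃ r : P →ₗ[Aᵐᵒᵖ] P, (∀ p, d (r p) = 0) ∧ ∀ p, d p = 0 → r p = p := by
  obtain ⟨Q, _, _, hQ, hPQ⟩ := exists_free_prod_free (R := Aᵐᵒᵖ) P
  have : Module.Free Aᵐᵒᵖ (P × Q × Q) :=
    Module.Free.of_equiv (LinearEquiv.prodAssoc Aᵐᵒᵖ P Q Q)
  -- Two copies of `Q` carry the exact differential (a, b) ↦ (0, a); the sum is free and still
  -- exact, and its cycles are computed componentwise, so a retraction compresses to `P`.
  let D : P × Q × Q →ₗ[Aᵐᵒᵖ] P × Q × Q :=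
    d.prodMap (LinearMap.inr Aᵐᵒᵖ Q Q ∘ₗ LinearMap.fst Aᵐᵒᵖ Q Q)
  have hD : ∀ x, D x = (d x.1, 0, x.2.1) := fun x => rfl
  let e := (Module.Free.chooseBasis Aᵐᵒᵖ (P × Q × Q)).repr
  let f := e.toLinearMap ∘ₗ D ∘ₗ e.symm.toLinearMap
  have hf_apply : ∀ p, f p = e (D (e.symm p)) := fun p => rfl
  have hf : ∀ p, f (f p) = 0 := fun p => by simp [hf_apply, hD, hd]
  have hf' : ∀ p, f p = 0 → ∃ q, f q = p := fun p hp => by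
    simp only [hf_apply, EmbeddingLike.map_eq_zero_iff, hD, Prod.mk_eq_zero] at hp
    obtain ⟨q, hq⟩ := hd' _ hp.1
    refine ⟨e (q, (e.symm p).2.2, 0), ?_⟩
    rw [hf_apply, LinearEquiv.symm_apply_apply, hD, ← LinearEquiv.eq_symm_apply]
    exact Prod.ext hq (Prod.ext hp.2.2.symm rfl)
  obtain ⟨r, hr, hr'⟩ := (isLocallySplitExact_of_tensorExact hf hf' fun M _ _ =>
    tensorExact_of_isLeftRegularRing hA hf hf' M).exists_retraction
  refine ⟨LinearMap.fst Aᵐᵒᵖ P (Q × Q) ∘ₗ e.symm.toLinearMap ∘ₗ r ∘ₗ e.toLinearMap ∘ₗ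
    LinearMap.inl Aᵐᵒᵖ P (Q × Q), fun p => ?_, fun p hp => ?_⟩
  · have := hr (e (p, 0))
    simp only [hf_apply, EmbeddingLike.map_eq_zero_iff, hD, Prod.mk_eq_zero] at this
    exact this.1
  · have := hr' (e (p, 0)) (by simp [hf_apply, hD, hp])
    simp [this]

end Contraction

/-! ### Complexes and their total differential -/

section Complex

variable {R : Type u} [Ring R]

/-- An exact complex of projective modules with compatible retractions onto its cycles is
contractible. -/
theorem isContractibleComplex_of_retractions (C : ChainComplex (ModuleCat.{u} R) ℤ)
    (hproj : ∀ n : ℤ, Module.Projective R (C.X n))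
    (hC : ∀ i j, i = j + 1 → ∀ x : C.X j, C.d j (j - 1) x = 0 → ∃ y : C.X i, C.d i j y = x)
    (hr : ∀ n, ∃ r : C.X n →ₗ[R] C.X n, (∀ x, C.d n (n - 1) (r x) = 0) ∧
      ∀ x, C.d n (n - 1) x = 0 → r x = x) : IsContractibleComplex C := by
  have hdd : ∀ i j k (x : C.X i), C.d j k (C.d i j x) = 0 := fun i j k x => by
    rw [← ConcreteCategory.comp_apply, C.d_comp_d]
    rfl
  choose r hr hr' using hr
  -- Lift `r i` through the differential, then apply `1 - r j` to force `r ∘ s = 0`. As `x - s (d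
  -- x)` is a cycle, `r` fixes it, so `r x = x - s (d x)`; together with `d (s x) = r x` this gives
  -- `1 = s d + d s`.
  have hs : ∀ i j, j = i + 1 → ∃ s : C.X i →ₗ[R] C.X j,
      (∀ x, C.d j i (s x) = r i x) ∧ ∀ x, r j (s x) = 0 := fun i j hij => by
    let Z := LinearMap.ker (C.d i (i - 1)).hom
    obtain ⟨s, hs⟩ := Module.projective_lifting_property
      (LinearMap.codRestrict Z (C.d j i).hom fun x => hdd j i (i - 1) x)
      (LinearMap.codRestrict Z (r i) fun x => hr i x)
      (fun z => by
        obtain ⟨y, hy⟩ := hC j i hij z.1 z.2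
        exact ⟨y, Subtype.ext hy⟩)
    have hs' : ∀ x, C.d j i (s x) = r i x := fun x =>
      congrArg Subtype.val (LinearMap.congr_fun hs x)
    obtain rfl : i = j - 1 := by omega
    refine ⟨(LinearMap.id - r j) ∘ₗ s, fun x => ?_, fun x => ?_⟩
    · rw [LinearMap.comp_apply, LinearMap.sub_apply, LinearMap.id_apply, map_sub, hs', hr,
        sub_zero]
    · rw [LinearMap.comp_apply, LinearMap.sub_apply, LinearMap.id_apply, map_sub,
        hr' j (r j (s x)) (hr j _), sub_self]
  choose s hs hs' using hs
  let h : ∀ i j, (ComplexShape.down ℤ).Rel j i → (C.X i ⟶ C.X j) := fun i j hij =>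
    ModuleCat.ofHom (s i j hij.symm)
  have key : 𝟙 C = Homotopy.nullHomotopicMap' h := by
    ext n x
    have h₁ : (ComplexShape.down ℤ).Rel (n + 1) n := rfl
    have h₀ : (ComplexShape.down ℤ).Rel n (n - 1) := sub_add_cancel n 1
    rw [Homotopy.nullHomotopicMap'_f h₁ h₀]
    change x = s (n - 1) n h₀.symm (C.d n (n - 1) x) + C.d (n + 1) n (s n (n + 1) h₁.symm x)
    rw [hs, add_comm, ← sub_eq_iff_eq_add]
    have h3 := hr' n (x - s (n - 1) n h₀.symm (C.d n (n - 1) x)) (by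
      rw [map_sub, hs, hr' (n - 1) _ (hdd _ _ _ _), sub_self])
    rw [map_sub, hs', sub_zero] at h3
    exact h3.symm
  exact ⟨(Homotopy.ofEq key).trans (Homotopy.nullHomotopy' h)⟩

open DirectSum in
/-- The total differential of a complex of modules. -/
noncomputable def totalDifferential (C : ChainComplex (ModuleCat.{u} R) ℤ) :
    (⨁ n, C.X n) →ₗ[R] (⨁ n, C.X n) :=
  DirectSum.toModule R ℤ _ fun n =>
    DirectSum.lof R ℤ (fun n => C.X n) (n - 1) ∘ₗ (C.d n (n - 1)).hom

theorem totalDifferential_lof (C : ChainComplex (ModuleCat.{u} R) ℤ) (n : ℤ) (x : C.X n) :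
    totalDifferential C (DirectSum.lof R ℤ (fun n => C.X n) n x) =
      DirectSum.lof R ℤ (fun n => C.X n) (n - 1) (C.d n (n - 1) x) :=
  DirectSum.toModule_lof (M := fun n => C.X n) R n x

open DirectSum in
theorem component_totalDifferential (C : ChainComplex (ModuleCat.{u} R) ℤ) (n : ℤ)
    (x : ⨁ n, C.X n) : totalDifferential C x (n - 1) = C.d n (n - 1) (x n) := by
  induction x using DirectSum.induction_on with
  | zero => simp
  | add x y hx hy => simp [hx, hy]
  | of m x =>
    change totalDifferential C (DirectSum.lof R ℤ (fun n => C.X n) m x) (n - 1) =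
      C.d n (n - 1) (DirectSum.lof R ℤ (fun n => C.X n) m x n)
    rw [totalDifferential_lof]
    by_cases h : m = n
    · subst h
      rw [DirectSum.lof_apply, DirectSum.lof_apply]
    · rw [DirectSum.lof_eq_of, DirectSum.lof_eq_of, DirectSum.of_eq_of_ne _ _ _ (by omega),
        DirectSum.of_eq_of_ne _ _ _ (by omega), map_zero]

end Complex

theorem theorem7 (A : Type u) [Ring A] (hA : IsLeftRegularRing A)
    (C : ChainComplex (ModuleCat.{u} (MulOpposite A)) ℤ)
    (hproj : ∀ n : ℤ, Module.Projective (MulOpposite A) (C.X n))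
    (hC : C.Acyclic) :
    IsContractibleComplex C := by
  have hex : ∀ i j, i = j + 1 → ∀ x : C.X j, C.d j (j - 1) x = 0 → ∃ y : C.X i, C.d i j y = x := by
    rintro i j rfl x hx
    have := (C.exactAt_iff' (j + 1) j (j - 1) (by simp) (by simp)).1 (hC j)
    exact (ShortComplex.moduleCat_exact_iff _).1 this x hx
  let l := fun n => DirectSum.lof Aᵐᵒᵖ ℤ (fun n => C.X n) n
  let D := totalDifferential C
  have hDl : ∀ n x, D (l n x) = l (n - 1) (C.d n (n - 1) x) := totalDifferential_lof C
  have hD : ∀ n x, D x (n - 1) = C.d n (n - 1) (x n) := component_totalDifferential C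
  have hD' : ∀ x, D x = 0 → ∀ n, C.d n (n - 1) (x n) = 0 := fun x hx n => by
    rw [← hD, hx]
    rfl
  obtain ⟨r, hr, hr'⟩ := exists_retraction_onto_cycles hA D
    (fun p => by
      induction p using DirectSum.induction_on with
      | zero => simp
      | add x y hx hy => rw [map_add, map_add, hx, hy, add_zero]
      | of m x =>
        change D (D (l m x)) = 0
        rw [hDl, hDl, ← ConcreteCategory.comp_apply, C.d_comp_d]
        exact map_zero _)
    (fun p hp => by
      classical
      have : p ∈ LinearMap.range D := by
        rw [← DirectSum.sum_support_of p]
        refine Submodule.sum_mem _ fun n _ => ?_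
        obtain ⟨y, hy⟩ := hex (n + 1) n rfl (p n) (hD' p hp n)
        refine ⟨l (n + 1) y, ?_⟩
        -- The target index `n + 1 - 1` is transported to `n`.
        have hcast : ∀ k, k = n → l k (C.d (n + 1) k y) = l n (C.d (n + 1) n y) := by
          rintro k rfl
          rfl
        rw [hDl, hcast _ (add_sub_cancel_right n 1), hy]
        rfl
      exact this)
  -- `r` need not respect degrees, but each component of a total cycle is a cycle, so its diagonal
  -- blocks are retractions.
  refine isContractibleComplex_of_retractions C hproj hex fun n =>
    ⟨DirectSum.component Aᵐᵒᵖ ℤ (fun n => C.X n) n ∘ₗ r ∘ₗ l n, fun x => hD' _ (hr _) n,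
      fun x hx => ?_⟩
  have := hr' (l n x) (by rw [hDl, hx, map_zero])
  rw [LinearMap.comp_apply, LinearMap.comp_apply, this]
  exact DirectSum.component.lof_self (M := fun n => C.X n) Aᵐᵒᵖ n x
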